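/- Let $K$ be an infinite field and let $n\ge 2$, $m\ge 1$ be integers. Let $T_n(K)$ be the algebra of upper triangular $n\times n$ matrices over $K$ and $J$ its Jacobson radical. For $t\ge 0$ let $T_n(K)^{(t)}$ be the set of matrices in $T_n(K)$ whose $(i,j)$ entries are zero whenever $j-i\le t$. Let $p=p(x_1,\dots,x_m)$ be a polynomial over $K$ in the noncommuting variables $x_1,\dots,x_m$ with zero constant term, and for a $K$-algebra $\mathcal A$ put $p(\mathcal A)=\{p(a_1,\dots,a_m) : a_1,\dots,a_m\in\mathcal A\}$. The order of $p$ is $0$ if $p(K)\ne\{0\}$; otherwise it is the least positive integer $r$ such that $p(T_r(K))=\{0\}$ and $p(T_{r+1}(K))\neq\{0\}$. Suppose that $p$ has order $r$, where $1<r<n-1$. Then $$p(T_n(K))+p(T_n(K))=T_n(K)^{(r-1)}=J^r,$$ where $p(T_n(K))+p(T_n(K))=\{a+b : a,b\in p(T_n(K))\}$. Moreover, if $r=n-2$, then $$p(T_n(K))=T_n(K)^{(n-3)}.$$ -/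

import Mathlib

open scoped Pointwise

/-- `T_n(K)`: the `K`-algebra of upper triangular `n × n` matrices over `K`. -/
def upperTriangular (K : Type*) [Field K] (n : ℕ) : Subalgebra K (Matrix (Fin n) (Fin n) K) where
  carrier := {A | A.IsUpperTriangular}
  mul_mem' hA hB := hA.mul hB
  add_mem' hA hB := hA.add hB
  algebraMap_mem' c := fun i j hij => by
    rw [Matrix.algebraMap_matrix_apply, if_neg (show i ≠ j from ne_of_gt hij)]

/-- `T_n(K)^{(t)}`: the upper triangular matrices whose `(i, j)` entries are zero for
`j - i ≤ t`. -/
def upperTriangularLevel (K : Type*) [Field K] (n t : ℕ) : Set (upperTriangular K n) :=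
  {A | ∀ i j : Fin n, ((j : ℕ) : ℤ) - ((i : ℕ) : ℤ) ≤ (t : ℤ) → A.1 i j = 0}

/-- `p(𝒜) = {p(a₁, …, a_m) | a₁, …, a_m ∈ 𝒜}`: the image of a noncommutative polynomial `p` in
`m` variables on a `K`-algebra `𝒜`. -/
def polyImage {K : Type*} [Field K] {m : ℕ} (p : FreeAlgebra K (Fin m))
    (𝒜 : Type*) [Ring 𝒜] [Algebra K 𝒜] : Set 𝒜 :=
  Set.range fun a : Fin m → 𝒜 => FreeAlgebra.lift K a p

/-- `ord(p) = r`: either `r = 0` and `p(K) ≠ {0}`, or `r` is the least positive integer with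
`p(T_r(K)) = {0}` and `p(T_{r+1}(K)) ≠ {0}`. -/
def HasOrder {K : Type*} [Field K] {m : ℕ} (p : FreeAlgebra K (Fin m)) (r : ℕ) : Prop :=
  (r = 0 ∧ polyImage p K ≠ {0}) ∨
    IsLeast {s : ℕ | 0 < s ∧ polyImage p (upperTriangular K s) = {0} ∧
      polyImage p (upperTriangular K (s + 1)) ≠ {0}} r

/-! ### Evaluation of noncommutative polynomials on triangular matrices -/

section Evaluation

variable {K : Type*} [Field K] {m : ℕ}

/-! Vanishing on `T_r(K)` forces every value of `p` into `J^r`: an entry `(i, j)` with `j - i < r`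
is an entry of `p` on an interval of at most `r` indices.

Conversely, adding `t • b` to the arguments, with `b` supported in rows `< k` and columns `≥ j`
where `k ≤ j`, changes `p` affinely in `t`. The slope is an entry of `p` on matrices from which the
indices between `k` and `j` are deleted (`lift_perturb`). If at most `r` indices remain, the slope
is zero. If `r + 1` remain, it depends only on diagonals and first superdiagonals
(`lift_corner_congr`), so it is nonzero for a tuple in general position, which exists since `K` is
infinite (`exists_corner_ne_zero`). Entries beyond the `r`-th superdiagonal can thus be corrected
one at a time. Diagonal conjugation adjusts the `r`-th superdiagonal, so every matrix of `J^r`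
without zeros there is a value of `p` (`exists_lift_eq_of_diagonal_ne_zero`).

Every matrix of `J^r` is a sum of two such matrices. If `n = r + 2`, the `r`-th superdiagonal has
only two entries; when one is zero, duplicating a row or column of a tuple from `T_{r+1}(K)` gives
the matrix directly. -/

theorem coe_lift_upperTriangular {n : ℕ} (a : Fin m → upperTriangular K n)
    (f : FreeAlgebra K (Fin m)) :
    (FreeAlgebra.lift K a f : Matrix (Fin n) (Fin n) K) =
      FreeAlgebra.lift K (fun l => (a l : Matrix (Fin n) (Fin n) K)) f := by
  induction f with
  | grade0 c => simp only [AlgHom.commutes]; rfl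
  | grade1 x => simp
  | mul f g hf hg => simp [hf, hg]
  | add f g hf hg => simp [hf, hg]

theorem lift_isUpperTriangular {n : ℕ} {a : Fin m → Matrix (Fin n) (Fin n) K}
    (ha : ∀ l, (a l).IsUpperTriangular) (f : FreeAlgebra K (Fin m)) :
    (FreeAlgebra.lift K a f).IsUpperTriangular := by
  have h := (FreeAlgebra.lift K (fun l => (⟨a l, ha l⟩ : upperTriangular K n)) f).2
  rw [coe_lift_upperTriangular] at h
  exact h

/-- If `a l * V = V * b l` for all `l`, then `f(a) * V = V * f(b)`. -/
theorem lift_mul_intertwine {ι κ : Type*} [Fintype ι] [DecidableEq ι] [Fintype κ] [DecidableEq κ]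
    {a : Fin m → Matrix ι ι K} {b : Fin m → Matrix κ κ K} {V : Matrix ι κ K}
    (h : ∀ l, a l * V = V * b l) (f : FreeAlgebra K (Fin m)) :
    FreeAlgebra.lift K a f * V = V * FreeAlgebra.lift K b f := by
  induction f with
  | grade0 c => simp [Algebra.algebraMap_eq_smul_one]
  | grade1 x => simpa using h x
  | mul f g hf hg => rw [map_mul, map_mul, Matrix.mul_assoc, hg, ← Matrix.mul_assoc, hf,
      Matrix.mul_assoc]
  | add f g hf hg => rw [map_add, map_add, Matrix.add_mul, Matrix.mul_add, hf, hg]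

/-- First order expansion of a noncommutative polynomial under a perturbation `b` supported in
the rows `< k` and the columns `≥ j`. The indices are restricted along `e`, which may only skip
indices between `k` and `j`. -/
theorem lift_perturb {n s k j : ℕ} (hkj : k ≤ j) {a b : Fin m → Matrix (Fin n) (Fin n) K}
    (ha : ∀ l, (a l).IsUpperTriangular)
    (hb : ∀ l (x y : Fin n), ¬ ((x : ℕ) < k ∧ j ≤ (y : ℕ)) → b l x y = 0) (t : K)
    {e : Fin s → Fin n} (he : StrictMono e) (hR : ∀ x, (e x : ℕ) < k ∨ j ≤ (e x : ℕ))
    (hS : ∀ x y z, e x ≤ z → z ≤ e y → z ∉ Set.range e →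
      (e x : ℕ) < k ∧ j ≤ (e y : ℕ) ∧ k ≤ (z : ℕ) ∧ (z : ℕ) < j)
    {C : Fin m → Matrix (Fin s) (Fin s) K}
    (hC : ∀ l x y, C l x y = if (e x : ℕ) < k ∧ j ≤ (e y : ℕ) then b l (e x) (e y)
      else a l (e x) (e y)) (f : FreeAlgebra K (Fin m)) :
    (∀ x y : Fin n, ¬ ((x : ℕ) < k ∧ j ≤ (y : ℕ)) →
      FreeAlgebra.lift K (a + t • b) f x y = FreeAlgebra.lift K a f x y) ∧
    (∀ x y : Fin s, ¬ ((e x : ℕ) < k ∧ j ≤ (e y : ℕ)) →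
      FreeAlgebra.lift K C f x y = FreeAlgebra.lift K a f (e x) (e y)) ∧
    (∀ x y : Fin s, ((e x : ℕ) < k ∧ j ≤ (e y : ℕ)) →
      FreeAlgebra.lift K (a + t • b) f (e x) (e y) =
        FreeAlgebra.lift K a f (e x) (e y) + t * FreeAlgebra.lift K C f x y) := by
  have ha' : ∀ l, ((a + t • b) l).IsUpperTriangular := by
    intro l x y hxy
    have h1 : (y : ℕ) < x := hxy
    have h2 : b l x y = 0 := hb l x y (by omega)
    have h3 : a l x y = 0 := ha l hxy
    simp [h2, h3]
  have hCt : ∀ l, (C l).IsUpperTriangular := by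
    intro l x y hxy
    have h1 : (e y : ℕ) < e x := he hxy
    rw [hC, if_neg (by omega)]
    exact ha l h1
  have T {f : FreeAlgebra K (Fin m)} {x y : Fin n} (h : y < x) :
    FreeAlgebra.lift K a f x y = 0 := lift_isUpperTriangular ha f h
  have T' {f : FreeAlgebra K (Fin m)} {x y : Fin n} (h : y < x) :
    FreeAlgebra.lift K (a + t • b) f x y = 0 := lift_isUpperTriangular ha' f h
  have TC {f : FreeAlgebra K (Fin m)} {x y : Fin s} (h : y < x) :
    FreeAlgebra.lift K C f x y = 0 := lift_isUpperTriangular hCt f h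
  induction f with
  | grade0 c =>
    simp only [AlgHom.commutes, Matrix.algebraMap_matrix_apply, he.injective.eq_iff]
    refine ⟨fun _ _ _ => trivial, fun _ _ _ => trivial, fun x y h => ?_⟩
    have : x ≠ y := by rintro rfl; omega
    simp [this]
  | grade1 l =>
    simp only [FreeAlgebra.lift_ι_apply]
    refine ⟨fun x y h => by simp [hb l x y h], fun x y h => by rw [hC, if_neg h],
      fun x y h => by rw [hC, if_pos h]; simp⟩
  | add f g hf hg =>
    simp only [map_add, Matrix.add_apply]
    refine ⟨fun x y h => by rw [hf.1 x y h, hg.1 x y h],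
      fun x y h => by rw [hf.2.1 x y h, hg.2.1 x y h],
      fun x y h => by rw [hf.2.2 x y h, hg.2.2 x y h]; ring⟩
  | mul f g hf hg =>
    simp only [map_mul, Matrix.mul_apply]
    refine ⟨fun x y h => ?_, fun x y h => ?_, fun x y h => ?_⟩
    · refine Finset.sum_congr rfl fun z _ => ?_
      by_cases h1 : z < x
      · rw [T h1, T' h1, zero_mul, zero_mul]
      by_cases h2 : y < z
      · rw [T h2, T' h2, mul_zero, mul_zero]
      rw [Fin.lt_def] at h1 h2
      rw [hf.1 x z (by omega), hg.1 z y (by omega)]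
    · refine Fintype.sum_of_injective e he.injective _ _ (fun z hz => ?_) (fun z => ?_)
      · by_cases h1 : z < e x
        · rw [T h1, zero_mul]
        by_cases h2 : e y < z
        · rw [T h2, mul_zero]
        have := hS x y z (not_lt.1 h1) (not_lt.1 h2) hz
        omega
      · by_cases h1 : z < x
        · rw [TC h1, T (he h1), zero_mul, zero_mul]
        by_cases h2 : y < z
        · rw [TC h2, T (he h2), mul_zero, mul_zero]
        have h3 := Fin.le_def.1 (he.monotone (not_lt.1 h1))
        have h4 := Fin.le_def.1 (he.monotone (not_lt.1 h2))
        rw [hf.2.1 x z (by omega), hg.2.1 z y (by omega)]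
    · rw [← sub_eq_iff_eq_add', ← Finset.sum_sub_distrib, Finset.mul_sum]
      symm
      refine Fintype.sum_of_injective e he.injective _ _ (fun z hz => ?_) (fun z => ?_)
      · by_cases h1 : z < e x
        · rw [T h1, T' h1, zero_mul, zero_mul, sub_zero]
        by_cases h2 : e y < z
        · rw [T h2, T' h2, mul_zero, mul_zero, sub_zero]
        have := hS x y z (not_lt.1 h1) (not_lt.1 h2) hz
        rw [hf.1 _ _ (by omega), hg.1 _ _ (by omega), sub_self]
      · by_cases h1 : z < x
        · rw [TC h1, T (he h1), T' (he h1)]; ring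
        by_cases h2 : y < z
        · rw [TC h2, T (he h2), T' (he h2)]; ring
        -- No `t ^ 2` term appears: since `k ≤ j`, an intermediate index lies in the rows `< k` or
        -- in the columns `≥ j`, so only one of the two factors is perturbed.
        rcases hR z with h3 | h3
        · rw [hf.2.1 _ _ (by omega), hf.1 _ _ (by omega), hg.2.2 _ _ (by omega)]; ring
        · rw [hg.2.1 _ _ (by omega), hg.1 _ _ (by omega), hf.2.2 _ _ (by omega)]; ring

/-- Evaluation commutes with restriction to an interval of indices. -/
theorem lift_submatrix {n s : ℕ} {a : Fin m → Matrix (Fin n) (Fin n) K}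
    (ha : ∀ l, (a l).IsUpperTriangular) {e : Fin s → Fin n} (he : StrictMono e)
    (hS : ∀ x y z, e x ≤ z → z ≤ e y → z ∈ Set.range e) (f : FreeAlgebra K (Fin m))
    (x y : Fin s) :
    FreeAlgebra.lift K (fun l => (a l).submatrix e e) f x y =
      FreeAlgebra.lift K a f (e x) (e y) :=
  -- With `k = 0` the perturbed block is empty, so `C` is just the restriction of `a`.
  (lift_perturb (k := 0) (j := 0) (b := 0) le_rfl ha (by simp) 0 he (by simp)
    (fun x y z h1 h2 h3 => absurd (hS x y z h1 h2) h3) (by simp) f).2.1 x y (by simp)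

/-- Used to rescale the `r`-th superdiagonal of a value of `p` without leaving the image. -/
theorem lift_diagonal_conj {n : ℕ} (a : Fin m → Matrix (Fin n) (Fin n) K) {d : Fin n → K}
    (hd : ∀ x, d x ≠ 0) (f : FreeAlgebra K (Fin m)) (x y : Fin n) :
    FreeAlgebra.lift K (fun l => Matrix.of fun x y => d x * a l x y / d y) f x y =
      d x * FreeAlgebra.lift K a f x y / d y := by
  have h := lift_mul_intertwine (a := fun l => Matrix.of fun x y => d x * a l x y / d y) (b := a)
    (V := Matrix.diagonal d) (fun l => by
      ext x y
      simp [Matrix.mul_diagonal, Matrix.diagonal_mul, hd y]) f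
  have h2 := congrFun (congrFun h x) y
  rw [Matrix.mul_diagonal, Matrix.diagonal_mul] at h2
  rw [eq_div_iff (hd y), h2]

end Evaluation

/-! ### Consequences of vanishing on `T_r(K)` -/

section Order

variable {K : Type*} [Field K] {m : ℕ}

theorem isUpperTriangular_submatrix {n s : ℕ} {A : Matrix (Fin n) (Fin n) K}
    (hA : A.IsUpperTriangular) {e : Fin s → Fin n} (he : StrictMono e) :
    (A.submatrix e e).IsUpperTriangular := fun _ _ hxy => hA (he hxy)

/-- The strictly monotone map onto `[i, k) ∪ [j, j']`. -/
theorem exists_gapEmbedding {n i k j j' s : ℕ} (hik : i ≤ k) (hkj : k ≤ j) (hj : j ≤ j')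
    (hj' : j' < n) (hs : s = (k - i) + (j' - j + 1)) :
    ∃ e : Fin s → Fin n, StrictMono e ∧
      (∀ x : Fin s, (e x : ℕ) = if (x : ℕ) < k - i then i + x else j + (x - (k - i))) ∧
      (∀ x, (e x : ℕ) < k ∨ j ≤ (e x : ℕ)) ∧
      (∀ x y z, e x ≤ z → z ≤ e y → z ∉ Set.range e →
        (e x : ℕ) < k ∧ j ≤ (e y : ℕ) ∧ k ≤ (z : ℕ) ∧ (z : ℕ) < j) := by
  have hlt (x : Fin s) : (if (x : ℕ) < k - i then i + x else j + (x - (k - i))) < n := by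
    have := x.2
    split_ifs <;> omega
  refine ⟨fun x => ⟨_, hlt x⟩, fun x y hxy => ?_, fun x => rfl, fun x => ?_,
    fun x y z hx hy hz => ?_⟩
  · have h : (x : ℕ) < y := hxy
    rw [Fin.lt_def]
    dsimp only
    split_ifs <;> omega
  · dsimp only
    split_ifs <;> omega
  · rw [Fin.le_def] at hx hy
    dsimp only at hx hy ⊢
    have h1 : ¬ (i ≤ (z : ℕ) ∧ (z : ℕ) < k) := fun h => hz
      ⟨⟨z - i, by omega⟩, Fin.ext (by dsimp only; split_ifs <;> omega)⟩
    have h2 : ¬ (j ≤ (z : ℕ) ∧ (z : ℕ) ≤ j') := fun h => hz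
      ⟨⟨z - j + (k - i), by omega⟩, Fin.ext (by dsimp only; split_ifs <;> omega)⟩
    have := x.2
    have := y.2
    split_ifs at hx hy ⊢ <;> omega

/-- A polynomial that vanishes on `T_r(K)` vanishes on `T_s(K)` for `s ≤ r`. -/
theorem lift_eq_zero_of_le {r s : ℕ} (hsr : s ≤ r) {p : FreeAlgebra K (Fin m)}
    (hp : ∀ a : Fin m → Matrix (Fin r) (Fin r) K, (∀ l, (a l).IsUpperTriangular) →
      FreeAlgebra.lift K a p = 0)
    {a : Fin m → Matrix (Fin s) (Fin s) K} (ha : ∀ l, (a l).IsUpperTriangular) :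
    FreeAlgebra.lift K a p = 0 := by
  let a' : Fin m → Matrix (Fin r) (Fin r) K := fun l => Matrix.of fun x y =>
    if h : (x : ℕ) < s ∧ (y : ℕ) < s then a l ⟨x, h.1⟩ ⟨y, h.2⟩ else 0
  have ha' : ∀ l, (a' l).IsUpperTriangular := by
    intro l x y hxy
    simp only [a', Matrix.of_apply]
    split_ifs with h
    · exact ha l hxy
    · rfl
  have hsub : (fun l => (a' l).submatrix (Fin.castLE hsr) (Fin.castLE hsr)) = a := by
    ext l x y
    simp [a']
  ext x y
  rw [← hsub, lift_submatrix ha' (Fin.strictMono_castLE hsr)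
    (fun x y z _ h2 => ⟨⟨z, lt_of_le_of_lt h2 y.2⟩, rfl⟩), hp a' ha']
  rfl

/-- If `p` vanishes on `T_r(K)` then `p(T_n(K)) ⊆ T_n(K)^{(r-1)}`. -/
theorem lift_apply_eq_zero {n r : ℕ} {p : FreeAlgebra K (Fin m)}
    (hp : ∀ a : Fin m → Matrix (Fin r) (Fin r) K, (∀ l, (a l).IsUpperTriangular) →
      FreeAlgebra.lift K a p = 0)
    {a : Fin m → Matrix (Fin n) (Fin n) K} (ha : ∀ l, (a l).IsUpperTriangular) {i j : Fin n}
    (hij : (j : ℕ) < i + r) : FreeAlgebra.lift K a p i j = 0 := by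
  rcases lt_or_ge j i with h | h
  · exact lift_isUpperTriangular ha p h
  rw [Fin.le_def] at h
  -- Both ends of the gap are `i`, so the embedding is the full interval `[i, j]`.
  obtain ⟨e, he, hev, -, hS⟩ := exists_gapEmbedding (le_refl (i : ℕ)) le_rfl h j.2 rfl
  have hei : e ⟨0, by omega⟩ = i := Fin.ext (by rw [hev]; dsimp only; split_ifs <;> omega)
  have hej : e ⟨i - i + (j - i), by omega⟩ = j :=
    Fin.ext (by rw [hev]; dsimp only; split_ifs <;> omega)
  have h0 := lift_submatrix ha he (fun x y z h1 h2 => ?_) p ⟨0, by omega⟩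
    ⟨i - i + (j - i), by omega⟩
  · rw [hei, hej] at h0
    rw [← h0, lift_eq_zero_of_le (by omega) hp fun l => isUpperTriangular_submatrix (ha l) he]
    rfl
  · by_contra h3
    have h4 := (hS x y z h1 h2 h3).1
    rw [hev] at h4
    split_ifs at h4 <;> omega

/-- Perturbing entries that can only be reached by at most `r - 1` steps does not change the
value of `p`. -/
theorem lift_perturb_eq {n r k j : ℕ} {p : FreeAlgebra K (Fin m)}
    (hp : ∀ a : Fin m → Matrix (Fin r) (Fin r) K, (∀ l, (a l).IsUpperTriangular) →
      FreeAlgebra.lift K a p = 0) (hkj : k ≤ j)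
    {a b : Fin m → Matrix (Fin n) (Fin n) K} (ha : ∀ l, (a l).IsUpperTriangular)
    (hb : ∀ l (x y : Fin n), ¬ ((x : ℕ) < k ∧ j ≤ (y : ℕ)) → b l x y = 0) (t : K) {x y : Fin n}
    (hxy : (x : ℕ) < k → j ≤ (y : ℕ) → (k - x) + (y - j + 1) ≤ r) :
    FreeAlgebra.lift K (a + t • b) p x y = FreeAlgebra.lift K a p x y := by
  by_cases h : (x : ℕ) < k ∧ j ≤ (y : ℕ)
  · obtain ⟨e, he, hev, hR, hS⟩ := exists_gapEmbedding h.1.le hkj h.2 y.2 rfl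
    let C : Fin m → Matrix (Fin (k - x + (y - j + 1))) (Fin (k - x + (y - j + 1))) K :=
      fun l => Matrix.of fun u v => if (e u : ℕ) < k ∧ j ≤ (e v : ℕ) then b l (e u) (e v)
        else a l (e u) (e v)
    have hC : ∀ l, (C l).IsUpperTriangular := by
      intro l u v huv
      have h1 : (e v : ℕ) < e u := he huv
      simp only [C, Matrix.of_apply]
      rw [if_neg (by omega)]
      exact ha l h1
    have key := (lift_perturb hkj ha hb t he hR hS (C := C) (fun _ _ _ => rfl) p).2.2
      ⟨0, by omega⟩ ⟨k - x + (y - j), by omega⟩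
    have hex : e ⟨0, by omega⟩ = x := Fin.ext (by rw [hev]; dsimp only; split_ifs <;> omega)
    have hey : e ⟨k - x + (y - j), by omega⟩ = y :=
      Fin.ext (by rw [hev]; dsimp only; split_ifs <;> omega)
    rw [hex, hey, lift_eq_zero_of_le (hxy h.1 h.2) hp hC] at key
    simpa using key h
  · exact (lift_perturb (s := 0) hkj ha hb t (e := Fin.elim0) (fun x => x.elim0)
      (fun x => x.elim0) (fun x => x.elim0) (C := fun _ => 0) (fun _ x => x.elim0) p).1 x y h

/-- If `p` vanishes on `T_r(K)`, the corner entry of its values on `T_{r+1}(K)` depends only on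
the diagonals and the first superdiagonals of the arguments. -/
theorem lift_corner_congr {r : ℕ} {p : FreeAlgebra K (Fin m)}
    (hp : ∀ a : Fin m → Matrix (Fin r) (Fin r) K, (∀ l, (a l).IsUpperTriangular) →
      FreeAlgebra.lift K a p = 0)
    {a b : Fin m → Matrix (Fin (r + 1)) (Fin (r + 1)) K} (ha : ∀ l, (a l).IsUpperTriangular)
    (hb : ∀ l, (b l).IsUpperTriangular)
    (hab : ∀ l (x y : Fin (r + 1)), (y : ℕ) ≤ x + 1 → a l x y = b l x y) :
    FreeAlgebra.lift K a p 0 (Fin.last r) = FreeAlgebra.lift K b p 0 (Fin.last r) := by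
  -- `Q` is the set of positions already switched from `a` to `b`; they are switched one by one.
  let c (Q : Finset (Fin (r + 1) × Fin (r + 1))) : Fin m → Matrix (Fin (r + 1)) (Fin (r + 1)) K :=
    fun l => Matrix.of fun x y => if (x, y) ∈ Q then b l x y else a l x y
  have hc Q l : (c Q l).IsUpperTriangular := by
    intro x y hxy
    simp [c, ha l hxy, hb l hxy]
  have key : ∀ Q, FreeAlgebra.lift K (c Q) p 0 (Fin.last r) =
      FreeAlgebra.lift K a p 0 (Fin.last r) := by
    intro Q
    induction Q using Finset.induction_on with
    | empty => congr 2
    | insert q Q hq ih =>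
      obtain ⟨k, j⟩ := q
      by_cases hkj : (j : ℕ) ≤ k + 1
      · rw [← ih]
        refine congrArg (fun a : Fin m → Matrix _ _ K => FreeAlgebra.lift K a p 0 (Fin.last r)) ?_
        ext l x y
        simp only [c, Matrix.of_apply, Finset.mem_insert, Prod.mk.injEq]
        by_cases h : x = k ∧ y = j
        · obtain ⟨rfl, rfl⟩ := h
          simp [hq, hab l x y hkj]
        · simp [h]
      -- A step from `k` to `j ≥ k + 2` skips an index, so at most `r` indices remain and the corner
      -- is unchanged.
      · rw [← ih, ← lift_perturb_eq hp (k := k + 1) (j := j) (by omega) (hc Q)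
          (b := fun l => Matrix.single k j (b l k j - a l k j)) (fun l x y h => ?_) 1 (fun _ _ => ?_)]
        · refine congrArg (fun a : Fin m → Matrix _ _ K => FreeAlgebra.lift K a p 0 (Fin.last r)) ?_
          ext l x y
          simp only [c, Matrix.of_apply, Finset.mem_insert, Prod.mk.injEq, one_smul, Pi.add_apply,
            Matrix.add_apply, Matrix.single_apply]
          by_cases h : x = k ∧ y = j
          · obtain ⟨rfl, rfl⟩ := h
            simp [hq]
          · have h' : ¬ (k = x ∧ j = y) := fun h' => h ⟨h'.1.symm, h'.2.symm⟩
            simp [h, h']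
        · rw [Matrix.single_apply, if_neg]
          rintro ⟨rfl, rfl⟩
          omega
        · have := j.2
          simp only [Fin.val_last, Fin.val_zero]
          omega
  rw [← key Finset.univ]
  refine congrArg (fun a : Fin m → Matrix _ _ K => FreeAlgebra.lift K a p 0 (Fin.last r)) ?_
  ext l x y
  simp [c]

end Order

/-! ### Solving for the entries beyond the `r`-th superdiagonal -/

section Solve

variable {K : Type*} [Field K] {m : ℕ}

theorem exists_lift_apply_eq_corner {n r : ℕ} (p : FreeAlgebra K (Fin m)) {x y : Fin n}
    (hxy : (y : ℕ) = x + r) :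
    ∃ e : Fin (r + 1) → Fin n, StrictMono e ∧ (∀ u, (e u : ℕ) = x + u) ∧
      ∀ a : Fin m → Matrix (Fin n) (Fin n) K, (∀ l, (a l).IsUpperTriangular) →
        FreeAlgebra.lift K a p x y =
          FreeAlgebra.lift K (fun l => (a l).submatrix e e) p 0 (Fin.last r) := by
  have hlt (u : Fin (r + 1)) : (x : ℕ) + u < n := by
    have := u.2
    have := y.2
    omega
  have he : StrictMono (fun u : Fin (r + 1) => (⟨x + u, hlt u⟩ : Fin n)) := by
    intro u v huv
    rw [Fin.lt_def] at huv ⊢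
    simpa using huv
  refine ⟨_, he, fun u => rfl, fun a ha => ?_⟩
  rw [lift_submatrix ha he (fun u v z h1 h2 => ?_)]
  · exact congrArg₂ (FreeAlgebra.lift K a p) (Fin.ext (by simp)) (Fin.ext (by simpa using hxy))
  · rw [Fin.le_def] at h1 h2
    dsimp only at h1 h2
    have := v.2
    exact ⟨⟨z - x, by omega⟩, Fin.ext (by dsimp only; omega)⟩

/-- If the corner entry of `p` does not vanish at the restrictions of `a₀`, then all matrices of
`T_n(K)^{(r-1)}` with the same `r`-th diagonal as `p(a₀)` are values of `p`. -/
theorem exists_lift_eq_of_corner_ne_zero {n r : ℕ} (hr : 1 ≤ r) {p : FreeAlgebra K (Fin m)}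
    (hp : ∀ a : Fin m → Matrix (Fin r) (Fin r) K, (∀ l, (a l).IsUpperTriangular) →
      FreeAlgebra.lift K a p = 0)
    {a₀ : Fin m → Matrix (Fin n) (Fin n) K} (ha₀ : ∀ l, (a₀ l).IsUpperTriangular)
    (hne : ∀ e : Fin (r + 1) → Fin n, StrictMono e →
      FreeAlgebra.lift K (fun l => (a₀ l).submatrix e e) p 0 (Fin.last r) ≠ 0)
    {T : Matrix (Fin n) (Fin n) K} (hT : ∀ x y : Fin n, (y : ℕ) < x + r → T x y = 0)
    (hTr : ∀ x y : Fin n, (y : ℕ) = x + r → T x y = FreeAlgebra.lift K a₀ p x y) :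
    ∃ a : Fin m → Matrix (Fin n) (Fin n) K, (∀ l, (a l).IsUpperTriangular) ∧
      FreeAlgebra.lift K a p = T := by
  -- The code `(y - x) * n + x` orders positions by superdiagonal, then by row. Keeping the
  -- diagonals and first superdiagonals of `a₀` preserves general position.
  have key : ∀ N : ℕ, ∃ a : Fin m → Matrix (Fin n) (Fin n) K, (∀ l, (a l).IsUpperTriangular) ∧
      (∀ l (x y : Fin n), (y : ℕ) ≤ x + 1 → a l x y = a₀ l x y) ∧
      ∀ x y : Fin n, ((y : ℕ) - x) * n + x < N → FreeAlgebra.lift K a p x y = T x y := by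
    intro N
    induction N with
    | zero => exact ⟨a₀, ha₀, fun _ _ _ _ => rfl, fun _ _ h => absurd h (Nat.not_lt_zero _)⟩
    | succ N ih =>
      obtain ⟨a, ha, haa₀, haN⟩ := ih
      by_cases hN : ∃ i j : Fin n, (i : ℕ) + r < j ∧ ((j : ℕ) - i) * n + i = N
      · obtain ⟨i, j, hij, rfl⟩ := hN
        obtain ⟨e, he, hev, hR, hS⟩ := exists_gapEmbedding (s := r + 1)
          (show (i : ℕ) ≤ i + r by omega) hij.le le_rfl j.2 (by omega)
        have hin : (i : ℕ) + r - 1 < n := by have := j.2; omega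
        -- The retained indices are `i, …, i + r - 1, j`. The entry `(q, j)` crosses the gap and
        -- becomes a first superdiagonal entry of `C`; taking it from `a₀` makes `C` agree there
        -- with a restriction of `a₀`.
        let q : Fin n := ⟨i + r - 1, hin⟩
        let b : Fin m → Matrix (Fin n) (Fin n) K := fun l => Matrix.single q j (a₀ l q j)
        have hb : ∀ l (x y : Fin n), ¬ ((x : ℕ) < i + r ∧ (j : ℕ) ≤ y) → b l x y = 0 := by
          intro l x y h
          simp only [b, Matrix.single_apply]
          rw [if_neg]
          rintro ⟨rfl, rfl⟩
          simp only [q] at h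
          omega
        let C : Fin m → Matrix (Fin (r + 1)) (Fin (r + 1)) K := fun l => Matrix.of fun u v =>
          if (e u : ℕ) < i + r ∧ (j : ℕ) ≤ e v then b l (e u) (e v) else a l (e u) (e v)
        have hC : ∀ l, (C l).IsUpperTriangular := by
          intro l u v huv
          have h1 : (e v : ℕ) < e u := he huv
          simp only [C, Matrix.of_apply]
          rw [if_neg (by omega)]
          exact ha l h1
        have hCne : FreeAlgebra.lift K C p 0 (Fin.last r) ≠ 0 := by
          rw [lift_corner_congr hp hC (fun l => isUpperTriangular_submatrix (ha₀ l) he)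
            fun l u v huv => ?_]
          · exact hne e he
          · have hu := hev u
            have hv := hev v
            have := u.2
            have := v.2
            simp only [C, Matrix.of_apply, Matrix.submatrix_apply]
            split_ifs with h
            · have h1 : e u = q := Fin.ext (by simp only [q]; split_ifs at hu hv <;> omega)
              have h2 : e v = j := Fin.ext (by split_ifs at hu hv <;> omega)
              simp [b, h1, h2]
            · exact haa₀ l _ _ (by split_ifs at hu hv <;> omega)
        have he0 : e 0 = i := Fin.ext (by rw [hev]; simp; omega)
        have her : e (Fin.last r) = j := Fin.ext (by rw [hev]; simp)
        let t : K := (T i j - FreeAlgebra.lift K a p i j) / FreeAlgebra.lift K C p 0 (Fin.last r)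
        have hval := (lift_perturb hij.le ha hb t he hR hS (C := C) (fun _ _ _ => rfl) p).2.2
          0 (Fin.last r) (by rw [he0, her]; omega)
        rw [he0, her] at hval
        refine ⟨a + t • b, fun l x y hxy => ?_, fun l x y hxy => ?_, fun x y hxy => ?_⟩
        · have h1 : (y : ℕ) < x := hxy
          have h2 : b l x y = 0 := hb l x y (by omega)
          simp [h2, ha l hxy]
        · rw [← haa₀ l x y hxy]
          have h2 : b l x y = 0 := hb l x y (by omega)
          simp [h2]
        · rcases Nat.lt_succ_iff_lt_or_eq.1 hxy with h | h
          · rw [← haN x y h]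
            -- Entries already fixed do not move: more than `r` retained indices would force `y - x
            -- ≥ j - i`, hence the same superdiagonal with `x < i`, contradicting `j ≤ y`.
            refine lift_perturb_eq hp hij.le ha hb t fun h1 h2 => ?_
            by_contra h3
            have h4 : (j : ℕ) - i ≤ y - x := by omega
            have h5 : (j : ℕ) - i = y - x := by
              refine le_antisymm h4 (not_lt.1 fun h5 => ?_)
              have := Nat.mul_le_mul_right n (Nat.succ_le_of_lt h5)
              rw [Nat.succ_mul] at this
              have := i.2
              omega
            rw [h5] at h
            omega
          · have h1 : (x : ℕ) = i := by
              have := congrArg (· % n) h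
              simpa [Nat.mul_add_mod_of_lt, Nat.mod_eq_of_lt] using this
            have h2 : (y : ℕ) - x = j - i := by
              rw [h1] at h ⊢
              refine Nat.eq_of_mul_eq_mul_right (show 0 < n by have := i.2; omega) ?_
              omega
            obtain rfl : x = i := Fin.ext h1
            obtain rfl : y = j := Fin.ext (by omega)
            rw [hval, div_mul_cancel₀ _ hCne]
            ring
      · refine ⟨a, ha, haa₀, fun x y hxy => ?_⟩
        rcases Nat.lt_succ_iff_lt_or_eq.1 hxy with h | h
        · exact haN x y h
        have h1 : (y : ℕ) ≤ x + r := not_lt.1 fun h1 => hN ⟨x, y, h1, h⟩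
        rcases h1.lt_or_eq with h2 | h2
        · rw [lift_apply_eq_zero hp ha h2, hT x y h2]
        · obtain ⟨e, he, hev, hval⟩ := exists_lift_apply_eq_corner p h2
          rw [hTr x y h2, hval a ha, hval a₀ ha₀]
          refine lift_corner_congr hp (fun l => isUpperTriangular_submatrix (ha l) he)
            (fun l => isUpperTriangular_submatrix (ha₀ l) he) fun l u v huv => ?_
          exact haa₀ l _ _ (by rw [hev, hev]; omega)
  obtain ⟨a, ha, -, h⟩ := key (n * n + n)
  refine ⟨a, ha, Matrix.ext fun x y => h x y ?_⟩
  have h1 : ((y : ℕ) - x) * n ≤ n * n := Nat.mul_le_mul_right n (by have := y.2; omega)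
  have := x.2
  omega

/-- Each residue class modulo `r` is an independent chain, along which `d` is the partial product of
`g`. -/
theorem exists_mul_recurrence {r : ℕ} (hr : 0 < r) (g : ℕ → K) (hg : ∀ x, g x ≠ 0) :
    ∃ d : ℕ → K, (∀ x, d x ≠ 0) ∧ ∀ x, d (x + r) = d x * g x := by
  refine ⟨fun x => ∏ q ∈ Finset.range (x / r), g (x % r + r * q),
    fun x => Finset.prod_ne_zero_iff.2 fun q _ => hg _, fun x => ?_⟩
  simp only [Nat.add_div_right x hr, Nat.add_mod_right, Finset.prod_range_succ, Nat.mod_add_div]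

/-- All matrices of `T_n(K)^{(r-1)}` without zeros on the `r`-th diagonal are values of `p`. -/
theorem exists_lift_eq_of_diagonal_ne_zero {n r : ℕ} (hr : 1 ≤ r) {p : FreeAlgebra K (Fin m)}
    (hp : ∀ a : Fin m → Matrix (Fin r) (Fin r) K, (∀ l, (a l).IsUpperTriangular) →
      FreeAlgebra.lift K a p = 0)
    {a₀ : Fin m → Matrix (Fin n) (Fin n) K} (ha₀ : ∀ l, (a₀ l).IsUpperTriangular)
    (hne : ∀ e : Fin (r + 1) → Fin n, StrictMono e →
      FreeAlgebra.lift K (fun l => (a₀ l).submatrix e e) p 0 (Fin.last r) ≠ 0)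
    {T : Matrix (Fin n) (Fin n) K} (hT : ∀ x y : Fin n, (y : ℕ) < x + r → T x y = 0)
    (hTr : ∀ x y : Fin n, (y : ℕ) = x + r → T x y ≠ 0) :
    ∃ a : Fin m → Matrix (Fin n) (Fin n) K, (∀ l, (a l).IsUpperTriangular) ∧
      FreeAlgebra.lift K a p = T := by
  have hF : ∀ x y : Fin n, (y : ℕ) = x + r → FreeAlgebra.lift K a₀ p x y ≠ 0 := by
    intro x y hxy
    obtain ⟨e, he, -, hval⟩ := exists_lift_apply_eq_corner p hxy
    rw [hval a₀ ha₀]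
    exact hne e he
  -- These ratios make conjugation by `d` carry the `r`-th superdiagonal of `p(a₀)` to that of `T`;
  -- outside the matrix the ratio is irrelevant and set to `1`.
  obtain ⟨d, hd, hdr⟩ := exists_mul_recurrence (K := K) hr
    (fun x => if h : x + r < n then
      FreeAlgebra.lift K a₀ p ⟨x, by omega⟩ ⟨x + r, h⟩ / T ⟨x, by omega⟩ ⟨x + r, h⟩ else 1)
    (fun x => by
      split_ifs with h
      · exact div_ne_zero (hF _ _ rfl) (hTr _ _ rfl)
      · exact one_ne_zero)
  obtain ⟨a, ha, hav⟩ := exists_lift_eq_of_corner_ne_zero hr hp ha₀ hne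
    (T := Matrix.of fun x y => T x y * d y / d x) (fun x y h => by simp [hT x y h])
    (fun x y h => by
      have h1 : (x : ℕ) + r < n := h ▸ y.2
      have h2 : y = ⟨x + r, h1⟩ := Fin.ext h
      have h3 := hTr x y h
      rw [Matrix.of_apply, h, hdr, dif_pos h1, ← h2]
      have := hd x
      field_simp)
  refine ⟨_, fun l x y hxy => ?_, Matrix.ext fun x y =>
    (lift_diagonal_conj a (d := fun x => d x) (fun x => hd x) p x y).trans ?_⟩
  · simp [ha l hxy]
  · rw [hav, Matrix.of_apply]
    have := hd x
    have := hd y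
    field_simp

end Solve

/-! ### Tuples in general position -/

section Generic

variable {K : Type*} [Field K] {m : ℕ}

theorem map_lift_matrix {R S ι : Type*} [CommRing R] [Algebra K R] [CommRing S] [Algebra K S]
    [Fintype ι] [DecidableEq ι] (φ : R →ₐ[K] S) (a : Fin m → Matrix ι ι R)
    (f : FreeAlgebra K (Fin m)) :
    (FreeAlgebra.lift K a f).map φ = FreeAlgebra.lift K (fun l => (a l).map φ) f := by
  have h : (φ.mapMatrix.comp (FreeAlgebra.lift K a)) =
      FreeAlgebra.lift K (fun l => (a l).map φ) := by
    ext : 1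
    funext l
    simp
  exact congrArg (fun F => F f) h

/-- A tuple in `T_n(K)` all of whose restrictions to `r + 1` indices are in general position. -/
theorem exists_corner_ne_zero [Infinite K] {r : ℕ} (n : ℕ) {p : FreeAlgebra K (Fin m)}
    {x : Fin m → Matrix (Fin (r + 1)) (Fin (r + 1)) K} (hx : ∀ l, (x l).IsUpperTriangular)
    (hpx : FreeAlgebra.lift K x p 0 (Fin.last r) ≠ 0) :
    ∃ a : Fin m → Matrix (Fin n) (Fin n) K, (∀ l, (a l).IsUpperTriangular) ∧
      ∀ e : Fin (r + 1) → Fin n, StrictMono e →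
        FreeAlgebra.lift K (fun l => (a l).submatrix e e) p 0 (Fin.last r) ≠ 0 := by
  classical
  let G : Fin m → Matrix (Fin n) (Fin n) (MvPolynomial (Fin m × Fin n × Fin n) K) := fun l =>
    Matrix.of fun i j => if i ≤ j then MvPolynomial.X (l, i, j) else 0
  let Q (e : Fin (r + 1) → Fin n) : MvPolynomial (Fin m × Fin n × Fin n) K :=
    FreeAlgebra.lift K (fun l => (G l).submatrix e e) p 0 (Fin.last r)
  have hQ (e : Fin (r + 1) → Fin n) (c : Fin m × Fin n × Fin n → K) :
      MvPolynomial.aeval c (Q e) = FreeAlgebra.lift K (fun l =>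
        ((Matrix.of fun i j => if i ≤ j then c (l, i, j) else 0 :
          Matrix (Fin n) (Fin n) K)).submatrix e e) p 0 (Fin.last r) := by
    have h := map_lift_matrix (MvPolynomial.aeval (R := K) c)
      (fun l => (G l).submatrix e e) p
    refine (congrFun (congrFun h 0) (Fin.last r)).trans ?_
    refine congrArg (fun a : Fin m → Matrix _ _ K => FreeAlgebra.lift K a p 0 (Fin.last r)) ?_
    ext l i j
    simp only [G, Matrix.map_apply, Matrix.submatrix_apply, Matrix.of_apply]
    split_ifs <;> simp
  have hQ0 : ∏ e with StrictMono e, Q e ≠ 0 := by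
    refine Finset.prod_ne_zero_iff.2 fun e he h0 => hpx ?_
    rw [Finset.mem_filter] at he
    -- Spreading `x` along `e` specializes `Q e` to the nonzero corner of `p(x)`.
    have h := hQ e (fun q => x q.1 (Function.invFun e q.2.1) (Function.invFun e q.2.2))
    rw [h0, map_zero] at h
    rw [h]
    refine congrArg (fun a : Fin m → Matrix _ _ K => FreeAlgebra.lift K a p 0 (Fin.last r)) ?_
    ext l i j
    simp only [Matrix.submatrix_apply, Matrix.of_apply, he.2.le_iff_le,
      Function.leftInverse_invFun he.2.injective _]
    split_ifs with hij
    · rfl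
    · exact hx l (not_le.1 hij)
  obtain ⟨c, hc⟩ : ∃ c, MvPolynomial.eval c (∏ e with StrictMono e, Q e) ≠ 0 := by
    by_contra! h
    exact hQ0 (MvPolynomial.funext fun c => by rw [h c, map_zero])
  rw [map_prod, Finset.prod_ne_zero_iff] at hc
  refine ⟨fun l => Matrix.of fun i j => if i ≤ j then c (l, i, j) else 0, fun l i j hij => ?_,
    fun e he => ?_⟩
  · exact if_neg (not_le.2 hij)
  · rw [← hQ e c]
    exact hc e (by simpa using he)

end Generic

/-! ### The case `n = r + 2` with a zero on the `r`-th superdiagonal -/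

section LastCase

variable {K : Type*} [Field K] {m : ℕ}

/-- Duplicating the first row of `x` realizes every matrix of `T_{r+2}(K)^{(r-1)}` with vanishing
`(0, r)` entry. -/
theorem exists_lift_eq_of_first_eq_zero {r : ℕ} (hr : 1 < r) {p : FreeAlgebra K (Fin m)}
    (hp : ∀ a : Fin m → Matrix (Fin r) (Fin r) K, (∀ l, (a l).IsUpperTriangular) →
      FreeAlgebra.lift K a p = 0)
    {x : Fin m → Matrix (Fin (r + 1)) (Fin (r + 1)) K} (hx : ∀ l, (x l).IsUpperTriangular)
    (hpx : FreeAlgebra.lift K x p 0 (Fin.last r) ≠ 0)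
    {T : Matrix (Fin (r + 2)) (Fin (r + 2)) K}
    (hT : ∀ i j : Fin (r + 2), (j : ℕ) < i + r → T i j = 0)
    (hT0 : T 0 (Fin.last r).castSucc = 0) :
    ∃ a : Fin m → Matrix (Fin (r + 2)) (Fin (r + 2)) K, (∀ l, (a l).IsUpperTriangular) ∧
      FreeAlgebra.lift K a p = T := by
  let φ := FreeAlgebra.lift K x p 0 (Fin.last r)
  -- The map `g` merges the indices `0` and `1`, and `V` duplicates row `0` with weights `c`. The
  -- relation `a l * V = V * x l` passes to `p`, so the two top entries of the last column become `c
  -- 0 * φ` and `c 1 * φ`.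
  let c : Fin (r + 2) → K := fun i => if i = 0 then T 0 (Fin.last (r + 1)) / φ else
    if i = 1 then T 1 (Fin.last (r + 1)) / φ else 1
  let g : Fin (r + 2) → Fin (r + 1) := fun i => ⟨i - 1, by omega⟩
  let V : Matrix (Fin (r + 2)) (Fin (r + 1)) K := Matrix.of fun i j => if j = g i then c i else 0
  let a : Fin m → Matrix (Fin (r + 2)) (Fin (r + 2)) K := fun l => Matrix.of fun i j =>
    if (j : ℕ) ≤ 1 then (if i = j then x l 0 0 else 0) else c i * x l (g i) (g j)
  have ha : ∀ l, (a l).IsUpperTriangular := by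
    intro l i j hij
    have h : (j : ℕ) < i := hij
    simp only [a, Matrix.of_apply]
    split_ifs with h1 h2
    · omega
    · rfl
    · rw [hx l (show g j < g i by simp only [g, Fin.lt_def]; omega), mul_zero]
  have hVx (A : Matrix (Fin (r + 1)) (Fin (r + 1)) K) (i j) : (V * A) i j = c i * A (g i) j := by
    simp [V, Matrix.mul_apply]
  have haV (A : Matrix (Fin (r + 2)) (Fin (r + 2)) K) (i) (j : Fin (r + 1)) (hj : j ≠ 0) :
      (A * V) i j = A i j.succ := by
    rw [Matrix.mul_apply, Finset.sum_eq_single j.succ]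
    · have h1 : g j.succ = j := Fin.ext (by simp [g])
      have h2 : j.succ ≠ 1 := by
        rw [← Fin.succ_zero_eq_one]
        exact fun h => hj (Fin.succ_injective _ h)
      simp [V, h1, c, h2]
    · intro k _ hk
      have h1 : j ≠ g k := by
        rintro rfl
        apply hk
        have : (k : ℕ) - 1 ≠ 0 := fun h => hj (Fin.ext h)
        exact Fin.ext (by simp only [g, Fin.val_succ]; omega)
      simp [V, h1]
    · simp
  have key := lift_mul_intertwine (a := a) (b := x) (V := V) (fun l => by
    ext i j
    rw [hVx]
    by_cases hj : j = 0
    · subst hj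
      have hg : ¬ (i : ℕ) ≤ 1 → 0 < g i := fun h => Fin.lt_def.2 (by
        simp only [g, Fin.val_zero]; omega)
      rw [Matrix.mul_apply, Finset.sum_eq_single i]
      · by_cases hi : (i : ℕ) ≤ 1
        · have h1 : g i = 0 := Fin.ext (by simp only [g, Fin.val_zero]; omega)
          simp [a, V, hi, h1, mul_comm]
        · have h0 : x l (g i) 0 = 0 := hx l (hg hi)
          rw [h0]
          simp [V, (hg hi).ne]
      · intro k _ hk
        by_cases hk1 : (k : ℕ) ≤ 1
        · simp [a, hk1, hk.symm]
        · have h1 : (0 : Fin (r + 1)) ≠ g k := fun h => hk1 (by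
            have := congrArg Fin.val h
            simp only [g, Fin.val_zero] at this
            omega)
          simp [V, h1]
      · simp
    · rw [haV _ _ _ hj]
      have h1 : g j.succ = j := Fin.ext (by simp [g])
      have h2 : ¬ ((j.succ : Fin (r + 2)) : ℕ) ≤ 1 := by
        have : (j : ℕ) ≠ 0 := fun h => hj (Fin.ext h)
        rw [Fin.val_succ]; omega
      simp only [a, Matrix.of_apply]
      rw [if_neg h2, h1]) p
  have hval (i : Fin (r + 2)) (j : Fin (r + 1)) (hj : j ≠ 0) :
      FreeAlgebra.lift K a p i j.succ = c i * FreeAlgebra.lift K x p (g i) j := by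
    rw [← haV (FreeAlgebra.lift K a p) i j hj, key, hVx]
  refine ⟨a, ha, Matrix.ext fun i j => ?_⟩
  by_cases hij : (j : ℕ) < i + r
  · rw [lift_apply_eq_zero hp ha hij, hT i j hij]
  have hj := j.2
  by_cases hjr : (j : ℕ) = r
  · have hi : i = 0 := Fin.ext (by simp only [Fin.val_zero]; omega)
    have hj' : j = (Fin.last r).castSucc := Fin.ext (by simpa using hjr)
    have h1 : j = Fin.succ ⟨r - 1, by omega⟩ := Fin.ext (by simp only [Fin.val_succ]; omega)
    rw [hi]
    nth_rw 2 [hj']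
    rw [hT0, h1, hval _ _ (fun h => by simp [Fin.ext_iff] at h; omega),
      lift_apply_eq_zero hp hx (by simp [g]; omega), mul_zero]
  · have h1 : j = (Fin.last r).succ := Fin.ext (by simp; omega)
    have h2 : g i = 0 := Fin.ext (by simp [g]; omega)
    rw [h1, hval _ _ (fun h => by simp [Fin.ext_iff] at h; omega), h2]
    by_cases hi : i = 0
    · simp only [c, hi]
      exact div_mul_cancel₀ _ hpx
    · have hi' : i = 1 := Fin.ext (by
        have : (i : ℕ) ≠ 0 := fun h => hi (Fin.ext h)
        rw [Fin.val_one]; omega)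
      simp only [c, hi', one_ne_zero, if_false, if_true]
      exact div_mul_cancel₀ _ hpx

/-- Duplicating the last column of `x` realizes every matrix of `T_{r+2}(K)^{(r-1)}` with
vanishing `(1, r + 1)` entry. -/
theorem exists_lift_eq_of_last_eq_zero {r : ℕ} (hr : 1 < r) {p : FreeAlgebra K (Fin m)}
    (hp : ∀ a : Fin m → Matrix (Fin r) (Fin r) K, (∀ l, (a l).IsUpperTriangular) →
      FreeAlgebra.lift K a p = 0)
    {x : Fin m → Matrix (Fin (r + 1)) (Fin (r + 1)) K} (hx : ∀ l, (x l).IsUpperTriangular)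
    (hpx : FreeAlgebra.lift K x p 0 (Fin.last r) ≠ 0)
    {T : Matrix (Fin (r + 2)) (Fin (r + 2)) K}
    (hT : ∀ i j : Fin (r + 2), (j : ℕ) < i + r → T i j = 0)
    (hT1 : T 1 (Fin.last (r + 1)) = 0) :
    ∃ a : Fin m → Matrix (Fin (r + 2)) (Fin (r + 2)) K, (∀ l, (a l).IsUpperTriangular) ∧
      FreeAlgebra.lift K a p = T := by
  let φ := FreeAlgebra.lift K x p 0 (Fin.last r)
  -- Dually, `g` merges `r` and `r + 1`, and `x l * V = V * a l` turns the last two entries of row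
  -- `0` into `φ * c j`.
  let c : Fin (r + 2) → K := fun j => if r ≤ (j : ℕ) then T 0 j / φ else 1
  let g : Fin (r + 2) → Fin (r + 1) := fun j => ⟨min j r, by omega⟩
  let V : Matrix (Fin (r + 1)) (Fin (r + 2)) K := Matrix.of fun i j => if i = g j then c j else 0
  let a : Fin m → Matrix (Fin (r + 2)) (Fin (r + 2)) K := fun l => Matrix.of fun i j =>
    if r ≤ (i : ℕ) then (if i = j then x l (Fin.last r) (Fin.last r) else 0)
    else x l (g i) (g j) * c j
  have ha : ∀ l, (a l).IsUpperTriangular := by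
    intro l i j hij
    have h : (j : ℕ) < i := hij
    simp only [a, Matrix.of_apply]
    split_ifs with h1 h2
    · omega
    · rfl
    · rw [hx l (show g j < g i by simp only [g, Fin.lt_def]; omega), zero_mul]
  have hxV (A : Matrix (Fin (r + 1)) (Fin (r + 1)) K) (i j) : (A * V) i j = A i (g j) * c j := by
    simp [V, Matrix.mul_apply]
  have hgc (i : Fin (r + 1)) : g i.castSucc = i :=
    Fin.ext (by simp only [g, Fin.val_castSucc]; omega)
  have hVa (A : Matrix (Fin (r + 2)) (Fin (r + 2)) K) (i : Fin (r + 1)) (j)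
      (hi : (i : ℕ) < r) : (V * A) i j = A i.castSucc j := by
    rw [Matrix.mul_apply, Finset.sum_eq_single i.castSucc]
    · simp [V, hgc, c, not_le.2 hi]
    · intro k _ hk
      have h1 : i ≠ g k := by
        rintro rfl
        apply hk
        simp only [g] at hi
        exact Fin.ext (by simp only [g, Fin.val_castSucc]; omega)
      simp [V, h1]
    · simp
  have key := lift_mul_intertwine (a := x) (b := a) (V := V) (fun l => by
    ext i j
    rw [hxV]
    by_cases hi : (i : ℕ) < r
    · rw [hVa _ _ _ hi]
      simp [a, hgc, not_le.2 hi]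
    · have hi' : i = Fin.last r := Fin.ext (by rw [Fin.val_last]; omega)
      subst hi'
      have hg : ¬ r ≤ (j : ℕ) → g j < Fin.last r := fun h => Fin.lt_def.2 (by
        simp only [g, Fin.val_last]; omega)
      rw [Matrix.mul_apply, Finset.sum_eq_single j]
      · by_cases hj : r ≤ (j : ℕ)
        · have h1 : g j = Fin.last r := Fin.ext (by simp only [g, Fin.val_last]; omega)
          simp [a, V, hj, h1, mul_comm]
        · have h0 : x l (Fin.last r) (g j) = 0 := hx l (hg hj)
          rw [h0]
          simp [V, (hg hj).ne']
      · intro k _ hk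
        by_cases hk1 : r ≤ (k : ℕ)
        · simp [a, hk1, hk]
        · have h1 : Fin.last r ≠ g k := fun h => hk1 (by
            have := congrArg Fin.val h
            simp only [g, Fin.val_last] at this
            omega)
          simp [V, h1]
      · simp) p
  have hval (i : Fin (r + 1)) (j : Fin (r + 2)) (hi : (i : ℕ) < r) :
      FreeAlgebra.lift K a p i.castSucc j = FreeAlgebra.lift K x p i (g j) * c j := by
    rw [← hVa (FreeAlgebra.lift K a p) i j hi, ← key, hxV]
  refine ⟨a, ha, Matrix.ext fun i j => ?_⟩
  by_cases hij : (j : ℕ) < i + r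
  · rw [lift_apply_eq_zero hp ha hij, hT i j hij]
  have hj := j.2
  have hi : i = (⟨i, by omega⟩ : Fin (r + 1)).castSucc := rfl
  by_cases hi0 : i = 0
  · subst hi0
    have h1 : r ≤ (j : ℕ) := by simpa using hij
    have h2 : g j = Fin.last r := Fin.ext (by simp only [g, Fin.val_last]; omega)
    have h3 := hval 0 j (by simp; omega)
    rw [Fin.castSucc_zero, h2] at h3
    rw [h3]
    simp only [c, if_pos h1]
    exact mul_div_cancel₀ _ hpx
  · have hi1 : (i : ℕ) ≠ 0 := fun h => hi0 (Fin.ext h)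
    have h1 : i = 1 := Fin.ext (by rw [Fin.val_one]; omega)
    have h2 : j = Fin.last (r + 1) := Fin.ext (by rw [Fin.val_last]; omega)
    rw [hi, hval _ _ (by dsimp only; omega), ← hi, lift_apply_eq_zero hp hx
      (by simp only [g]; omega), zero_mul, h1, h2, hT1]

end LastCase

/-! ### Powers of the Jacobson radical -/

section Jacobson

variable (K : Type*) [Field K] (n : ℕ)

/-- `T_n(K)^{(t-1)}` as a left ideal. -/
def upperTriangularIdeal (t : ℕ) : Ideal (upperTriangular K n) where
  carrier := {A | ∀ i j : Fin n, (j : ℕ) < i + t → A.1 i j = 0}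
  add_mem' {A B} hA hB i j h := by simp [hA i j h, hB i j h]
  zero_mem' i j _ := rfl
  smul_mem' A B hB i j h := by
    refine (Matrix.mul_apply ..).trans (Finset.sum_eq_zero fun k _ => ?_)
    by_cases hk : k < i
    · rw [A.2 hk, zero_mul]
    · rw [Fin.lt_def] at hk
      rw [hB k j (by omega), mul_zero]

variable {K n}

theorem coe_upperTriangularIdeal {t : ℕ} (ht : 1 ≤ t) :
    (upperTriangularIdeal K n t : Set (upperTriangular K n)) = upperTriangularLevel K n (t - 1) := by
  ext A
  refine forall_congr' fun i => forall_congr' fun j => ?_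
  have : (j : ℕ) < i + t ↔ ((j : ℕ) : ℤ) - ((i : ℕ) : ℤ) ≤ ((t - 1 : ℕ) : ℤ) := by omega
  rw [this]

theorem mul_mem_upperTriangularIdeal {s t : ℕ} {A B : upperTriangular K n}
    (hA : A ∈ upperTriangularIdeal K n s) (hB : B ∈ upperTriangularIdeal K n t) :
    A * B ∈ upperTriangularIdeal K n (s + t) := by
  intro i j h
  refine (Matrix.mul_apply ..).trans (Finset.sum_eq_zero fun k _ => ?_)
  by_cases hk : (k : ℕ) < i + s
  · rw [hA i k hk, zero_mul]
  · rw [hB k j (by omega), mul_zero]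

/-- Column `0` of a matrix in the right-hand ideal vanishes, so shifting columns left loses nothing
and multiplication by the superdiagonal shift `S` restores the matrix. -/
theorem upperTriangularIdeal_mul {t : ℕ} (ht : 1 ≤ t) :
    upperTriangularIdeal K n t * upperTriangularIdeal K n 1 = upperTriangularIdeal K n (t + 1) := by
  refine le_antisymm (Ideal.mul_le.2 fun A hA B hB => mul_mem_upperTriangularIdeal hA hB)
    fun A hA => ?_
  -- shift the columns of `A` to the left
  let B : Matrix (Fin n) (Fin n) K := Matrix.of fun i j =>
    if h : (j : ℕ) + 1 < n then A.1 i ⟨j + 1, h⟩ else 0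
  let S : Matrix (Fin n) (Fin n) K := Matrix.of fun i j => if (j : ℕ) = i + 1 then 1 else 0
  have hB : ∀ i j : Fin n, (j : ℕ) < i + t → B i j = 0 := by
    intro i j h
    simp only [B, Matrix.of_apply]
    split_ifs with h1
    · exact hA i _ (by dsimp only; omega)
    · rfl
  have hS : ∀ i j : Fin n, (j : ℕ) < i + 1 → S i j = 0 := fun i j h => if_neg (by omega)
  have hB' : B ∈ upperTriangular K n := fun i j h => hB i j (by
    have : (j : ℕ) < i := h
    omega)
  have hS' : S ∈ upperTriangular K n := fun i j h => hS i j (by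
    have : (j : ℕ) < i := h
    omega)
  have hA' : A = (⟨B, hB'⟩ : upperTriangular K n) * ⟨S, hS'⟩ := by
    ext i j
    refine Eq.trans ?_ (Matrix.mul_apply ..).symm
    by_cases hj : (j : ℕ) = 0
    · rw [hA i j (by omega), Finset.sum_eq_zero fun k _ => ?_]
      simp [S, hj]
    · rw [Finset.sum_eq_single ⟨j - 1, by omega⟩]
      · have h1 : (j : ℕ) - 1 + 1 = j := by omega
        simp [B, S, h1]
      · intro k _ hk
        have : ¬ (j : ℕ) = k + 1 := fun h => hk (Fin.ext (by dsimp only; omega))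
        simp [S, this]
      · simp
  rw [hA']
  exact Ideal.mul_mem_mul hB hS

theorem upperTriangularIdeal_one_pow {t : ℕ} (ht : 1 ≤ t) :
    upperTriangularIdeal K n 1 ^ t = upperTriangularIdeal K n t := by
  induction t, ht using Nat.le_induction with
  | base => exact Submodule.pow_one _
  | succ t ht ih => rw [Submodule.pow_succ, ih, upperTriangularIdeal_mul ht]

theorem pow_mem_upperTriangularIdeal {A : upperTriangular K n}
    (hA : A ∈ upperTriangularIdeal K n 1) (t : ℕ) : A ^ t ∈ upperTriangularIdeal K n t := by
  induction t with
  | zero => exact fun i j h => (A ^ 0).2 (show j < i from h)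
  | succ t ih => rw [pow_succ]; exact mul_mem_upperTriangularIdeal ih hA

theorem jacobson_upperTriangular :
    Ring.jacobson (upperTriangular K n) = upperTriangularIdeal K n 1 := by
  rw [← Ideal.jacobson_bot]
  ext A
  rw [Ideal.mem_jacobson_iff]
  constructor
  · intro h i j hij
    rcases Nat.lt_succ_iff_lt_or_eq.1 hij with h1 | h1
    · exact A.2 h1
    obtain rfl : j = i := Fin.ext h1
    by_contra h0
    -- For this scalar the `(j, j)` entry of the quasi-inverse equation reads `-z + z - 1 = 0`.
    obtain ⟨Z, hZ⟩ := h (algebraMap K _ (-(A.1 j j)⁻¹))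
    have h2 : Z.1 * (algebraMap K (Matrix (Fin n) (Fin n) K) (-(A.1 j j)⁻¹)) * A.1 + Z.1 - 1 = 0 :=
      congrArg Subtype.val ((Submodule.mem_bot _).1 hZ)
    have h3 := congrFun (congrFun h2 j) j
    have h4 : (Z.1 * A.1) j j = Z.1 j j * A.1 j j := by
      rw [Matrix.mul_apply, Finset.sum_eq_single j]
      · intro k _ hk
        rcases lt_or_gt_of_ne hk with hk | hk
        · rw [Z.2 hk, zero_mul]
        · rw [A.2 hk, mul_zero]
      · simp
    rw [Algebra.algebraMap_eq_smul_one] at h3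
    simp only [Matrix.mul_smul, mul_one, Matrix.smul_mul, Matrix.sub_apply, Matrix.add_apply,
      Matrix.smul_apply, h4, Matrix.one_apply_eq, Matrix.zero_apply, smul_eq_mul] at h3
    field_simp at h3
    simp at h3
  · intro hA Y
    have hYA : Y * A ∈ upperTriangularIdeal K n 1 := Ideal.mul_mem_left _ Y hA
    have hnil : IsNilpotent (Y * A) := ⟨n, by
      ext i j
      exact pow_mem_upperTriangularIdeal hYA n i j (by omega)⟩
    obtain ⟨u, hu⟩ := hnil.isUnit_add_one
    refine ⟨(↑u⁻¹ : upperTriangular K n), (Submodule.mem_bot _).2 ?_⟩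
    rw [mul_assoc, ← mul_add_one, ← hu, Units.inv_mul, sub_self]

end Jacobson

theorem exists_ne_zero_sub_ne_zero (K : Type*) [Field K] [Infinite K] (x : K) :
    ∃ y : K, y ≠ 0 ∧ x - y ≠ 0 := by
  classical
  obtain ⟨y, hy⟩ := Infinite.exists_notMem_finset ({0, x} : Finset K)
  simp only [Finset.mem_insert, Finset.mem_singleton, not_or] at hy
  exact ⟨y, hy.1, sub_ne_zero.2 (Ne.symm hy.2)⟩

/-! ### The image of `p` and the main theorem -/

section Image

variable {K : Type*} [Field K] {m : ℕ}

theorem mem_polyImage_upperTriangular {n : ℕ} {p : FreeAlgebra K (Fin m)}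
    {A : upperTriangular K n} :
    A ∈ polyImage p (upperTriangular K n) ↔ ∃ a : Fin m → Matrix (Fin n) (Fin n) K,
      (∀ l, (a l).IsUpperTriangular) ∧ FreeAlgebra.lift K a p = A.1 := by
  constructor
  · rintro ⟨a, rfl⟩
    exact ⟨fun l => (a l).1, fun l => (a l).2, (coe_lift_upperTriangular a p).symm⟩
  · rintro ⟨a, ha, h⟩
    exact ⟨fun l => ⟨a l, ha l⟩, Subtype.ext ((coe_lift_upperTriangular _ p).trans h)⟩

end Image

theorem theorem1p3 {K : Type*} [Field K] [Infinite K] (n m r : ℕ) (hn : 2 ≤ n) (hm : 1 ≤ m)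
    (p : FreeAlgebra K (Fin m))
    -- the constant term of `p` is zero
    (hp : FreeAlgebra.algebraMapInv p = 0)
    (hord : HasOrder p r) (hr1 : 1 < r) (hrn : r < n - 1) :
    polyImage p (upperTriangular K n) + polyImage p (upperTriangular K n) =
        upperTriangularLevel K n (r - 1) ∧
      upperTriangularLevel K n (r - 1) = ((Ring.jacobson (upperTriangular K n) ^ r :
        Ideal (upperTriangular K n)) : Set (upperTriangular K n)) ∧
      (r = n - 2 → polyImage p (upperTriangular K n) = upperTriangularLevel K n (n - 3)) := by
  obtain ⟨hvan, hnv⟩ : polyImage p (upperTriangular K r) = {0} ∧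
      polyImage p (upperTriangular K (r + 1)) ≠ {0} := by
    rcases hord with h | h
    · omega
    · exact h.1.2
  have hpr : ∀ a : Fin m → Matrix (Fin r) (Fin r) K, (∀ l, (a l).IsUpperTriangular) →
      FreeAlgebra.lift K a p = 0 := by
    intro a ha
    have h : (⟨FreeAlgebra.lift K a p, lift_isUpperTriangular ha p⟩ : upperTriangular K r) ∈
        polyImage p (upperTriangular K r) := mem_polyImage_upperTriangular.2 ⟨a, ha, rfl⟩
    rw [hvan] at h
    exact congrArg Subtype.val h
  -- On `T_{r+1}(K)` only the corner entry of a value of `p` can be nonzero.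
  obtain ⟨x, hx, hpx⟩ : ∃ x : Fin m → Matrix (Fin (r + 1)) (Fin (r + 1)) K,
      (∀ l, (x l).IsUpperTriangular) ∧ FreeAlgebra.lift K x p 0 (Fin.last r) ≠ 0 := by
    by_contra! h
    refine hnv (Set.eq_singleton_iff_nonempty_unique_mem.2 ⟨Set.range_nonempty _, fun A hA => ?_⟩)
    obtain ⟨a, ha, haA⟩ := mem_polyImage_upperTriangular.1 hA
    ext i j
    rw [← haA]
    by_cases hij : (j : ℕ) < i + r
    · exact lift_apply_eq_zero hpr ha hij
    · have hi : i = 0 := Fin.ext (by rw [Fin.val_zero]; omega)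
      have hj : j = Fin.last r := Fin.ext (by rw [Fin.val_last]; omega)
      rw [hi, hj]
      exact h a ha
  obtain ⟨a₀, ha₀, hne⟩ := exists_corner_ne_zero n hx hpx
  have hmem : ∀ A ∈ upperTriangularIdeal K n r, (∀ i j : Fin n, (j : ℕ) = i + r → A.1 i j ≠ 0) →
      A ∈ polyImage p (upperTriangular K n) := fun A hA hA' =>
    mem_polyImage_upperTriangular.2 (exists_lift_eq_of_diagonal_ne_zero hr1.le hpr ha₀ hne hA hA')
  have hsub : polyImage p (upperTriangular K n) ⊆ upperTriangularIdeal K n r := by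
    intro A hA i j hij
    obtain ⟨a, ha, haA⟩ := mem_polyImage_upperTriangular.1 hA
    rw [← haA]
    exact lift_apply_eq_zero hpr ha hij
  rw [← coe_upperTriangularIdeal hr1.le]
  refine ⟨subset_antisymm ?_ fun A hA => ?_, ?_, fun hrn2 => ?_⟩
  · rintro _ ⟨A, hA, B, hB, rfl⟩
    exact add_mem (hsub hA) (hsub hB)
  -- Each entry of the `r`-th superdiagonal is split into two nonzero scalars; `B` takes one
  -- summand, and `A - B` keeps the other together with all higher entries.
  · choose u hu hAu using exists_ne_zero_sub_ne_zero K
    let B : Matrix (Fin n) (Fin n) K := Matrix.of fun i j =>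
      if (j : ℕ) = i + r then u (A.1 i j) else 0
    have hB : ∀ i j : Fin n, (j : ℕ) < i + r → B i j = 0 := fun i j h => if_neg (by omega)
    have hB' : B ∈ upperTriangular K n := fun i j h => hB i j (by
      have : (j : ℕ) < i := h
      omega)
    have hBI : (⟨B, hB'⟩ : upperTriangular K n) ∈ upperTriangularIdeal K n r := hB
    refine ⟨⟨B, hB'⟩, hmem _ hBI fun i j h => ?_, A - ⟨B, hB'⟩,
      hmem _ (sub_mem hA hBI) fun i j h => ?_, add_sub_cancel _ _⟩
    · simp [B, h, hu]
    · simp [B, h, hAu]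
  · rw [jacobson_upperTriangular, upperTriangularIdeal_one_pow hr1.le]
  · have h3 : n - 3 = r - 1 := by omega
    rw [h3, ← coe_upperTriangularIdeal hr1.le]
    refine subset_antisymm hsub fun A hA => ?_
    obtain rfl : n = r + 2 := by omega
    by_cases h0 : A.1 0 (Fin.last r).castSucc = 0
    · exact mem_polyImage_upperTriangular.2 (exists_lift_eq_of_first_eq_zero hr1 hpr hx hpx hA h0)
    by_cases h1 : A.1 1 (Fin.last (r + 1)) = 0
    · exact mem_polyImage_upperTriangular.2 (exists_lift_eq_of_last_eq_zero hr1 hpr hx hpx hA h1)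
    refine hmem A hA fun i j hij => ?_
    have hj := j.2
    by_cases hi : i = 0
    · have : j = (Fin.last r).castSucc := Fin.ext (by simp [hij, hi])
      rwa [hi, this]
    · have hi' : (i : ℕ) ≠ 0 := fun h => hi (Fin.ext h)
      have h2 : i = 1 := Fin.ext (by rw [Fin.val_one]; omega)
      have h4 : j = Fin.last (r + 1) := Fin.ext (by rw [Fin.val_last]; omega)
      rwa [h2, h4]
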